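/- Let $r\ge 1$ and $n\ge 0$ be integers and let $A_k,B_k,C_k,D_k\in\mathbb C^{n\times n}$ for $k=1,\dots,r$. Indices are taken modulo $r$, so that $X_{r+1}=X_1$. The periodic system of generalized Sylvester equations $$A_kX_kB_k-C_kX_{k+1}D_k=E_k,\qquad k=1,\dots,r,$$ is called nonsingular if for every choice of $E_1,\dots,E_r\in\mathbb C^{n\times n}$ it has exactly one solution $(X_1,\dots,X_r)\in(\mathbb C^{n\times n})^r$. For matrices $M_k,N_k\in\mathbb C^{n\times n}$ ($k=1,\dots,r$; the $N_k$ need not be invertible), a formal periodic Schur form of the formal matrix product $N_r^{-1}M_rN_{r-1}^{-1}M_{r-1}\cdots N_1^{-1}M_1$, or of the formal matrix product $M_rN_{r-1}^{-1}M_{r-1}\cdots N_1^{-1}M_1N_r^{-1}$, consists of upper triangular matrices $T_k=Q_k^{\mathsf H}M_kZ_k$ and $R_k=Q_k^{\mathsf H}N_kZ_{k+1}$, $k=1,\dots,r$, with $Q_k,Z_k$ unitary and $Z_{r+1}=Z_1$. The formal product is regular if it has such a form in which, for every $i\in\{1,\dots,n\}$, the numbers $\prod_{k=1}^r(T_k)_{ii}$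 and $\prod_{k=1}^r(R_k)_{ii}$ are not both zero. The spectrum of a regular formal product is the set of its eigenvalues $$\lambda_i=\frac{\prod_{k=1}^r(T_k)_{ii}}{\prod_{k=1}^r(R_k)_{ii}}\in\mathbb C\cup\{\infty\},\qquad i=1,\dots,n,$$ where $a/0=\infty$ for $a\ne0$. (Such a form always exists, and regularity and spectrum do not depend on which form is used.) Theorem. The periodic system above is nonsingular if and only if the two formal matrix products $$C_r^{-1}A_rC_{r-1}^{-1}A_{r-1}\cdots C_1^{-1}A_1\qquad\text{and}\qquad D_rB_r^{-1}D_{r-1}B_{r-1}^{-1}\cdots D_1B_1^{-1}$$ are both regular and their spectra are disjoint. -/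

import Mathlib

/-- A formal matrix product with `r` numerator factors `M_k` and `r` denominator factors `N_k`,
indexed cyclically by `Fin r` (so that `k + 1` means `k + 1` modulo `r`).  The data stand for
`N_r⁻¹ M_r N_{r-1}⁻¹ M_{r-1} ⋯ N_1⁻¹ M_1`, or for its cyclic rotation
`M_r N_{r-1}⁻¹ M_{r-1} ⋯ N_1⁻¹ M_1 N_r⁻¹`; regularity and eigenvalues of both are given by the
same formulas.  No factor is required to be invertible. -/
structure FormalProduct (r n : ℕ) where
  /-- the factors `M_k` (exponent `1`) -/
  M : Fin r → Matrix (Fin n) (Fin n) ℂ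
  /-- the factors `N_k` (exponent `-1`) -/
  N : Fin r → Matrix (Fin n) (Fin n) ℂ

namespace FormalProduct

/-- The formal product `N_r⁻¹ M_r N_{r-1}⁻¹ M_{r-1} ⋯ N_1⁻¹ M_1`. -/
def invMul {r n : ℕ} (N M : Fin r → Matrix (Fin n) (Fin n) ℂ) : FormalProduct r n :=
  ⟨M, N⟩

/-- The formal product `M_r N_r⁻¹ M_{r-1} N_{r-1}⁻¹ ⋯ M_1 N_1⁻¹`.  The inverted factor that stands
between `M_{k+1}` and `M_k` is `N_{k+1}`, and the last one (to the right of `M_1`) is `N_1`, so the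
`k`-th denominator factor in the sense of `FormalProduct` is `N_{k+1}` (indices modulo `r`). -/
def mulInv {r n : ℕ} [NeZero r] (M N : Fin r → Matrix (Fin n) (Fin n) ℂ) : FormalProduct r n :=
  ⟨M, fun k => N (k + 1)⟩

/-- `(T, R)` is a formal periodic Schur form of `P`: there are unitary `Q_k`, `Z_k` such that
`T_k = Q_kᴴ M_k Z_k` and `R_k = Q_kᴴ N_k Z_{k+1}` are upper triangular, where `Z_{r+1} = Z_1`. -/
def IsPeriodicSchurForm {r n : ℕ} [NeZero r] (P : FormalProduct r n)
    (T R : Fin r → Matrix (Fin n) (Fin n) ℂ) : Prop :=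
  ∃ Q Z : Fin r → Matrix (Fin n) (Fin n) ℂ,
    (∀ k, Q k ∈ Matrix.unitaryGroup (Fin n) ℂ) ∧
    (∀ k, Z k ∈ Matrix.unitaryGroup (Fin n) ℂ) ∧
    (∀ k, (Q k).conjTranspose * P.M k * Z k = T k) ∧
    (∀ k, (Q k).conjTranspose * P.N k * Z (k + 1) = R k) ∧
    (∀ k, (T k).BlockTriangular id) ∧
    (∀ k, (R k).BlockTriangular id)

/-- `P` is regular: in a formal periodic Schur form of `P` (which one does not matter), the two
products `∏ k, (T_k)_{ii}` and `∏ k, (R_k)_{ii}` do not both vanish, for any `i`. -/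
def IsRegular {r n : ℕ} [NeZero r] (P : FormalProduct r n) : Prop :=
  ∃ T R : Fin r → Matrix (Fin n) (Fin n) ℂ, P.IsPeriodicSchurForm T R ∧
    ∀ i, ¬ (∏ k, T k i i = 0 ∧ ∏ k, R k i i = 0)

open Classical in
/-- The ratio `a / b` in `ℂ ∪ {∞}`, with `a / 0 = ∞` (only meant for `(a, b) ≠ (0, 0)`). -/
noncomputable def ratio (a b : ℂ) : OnePoint ℂ :=
  if b = 0 then OnePoint.infty else ((a / b : ℂ) : OnePoint ℂ)

/-- The spectrum of a (regular) formal product: the set of its eigenvalues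
`λ_i = ∏ k, (T_k)_{ii} / ∏ k, (R_k)_{ii} ∈ ℂ ∪ {∞}`, computed from a formal periodic Schur form
(which one does not matter). -/
def spectrum {r n : ℕ} [NeZero r] (P : FormalProduct r n) : Set (OnePoint ℂ) :=
  {z | ∃ T R : Fin r → Matrix (Fin n) (Fin n) ℂ, P.IsPeriodicSchurForm T R ∧
    ∃ i, z = ratio (∏ k, T k i i) (∏ k, R k i i)}

end FormalProduct

/-- The periodic system `A_k X_k B_k - C_k X_{k+1} D_k = E_k` (`X_{r+1} = X_1`) is nonsingular:
it has exactly one solution for every right-hand side. -/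
def PeriodicSylvesterNonsingular {r n : ℕ} [NeZero r]
    (A B C D : Fin r → Matrix (Fin n) (Fin n) ℂ) : Prop :=
  ∀ E : Fin r → Matrix (Fin n) (Fin n) ℂ, ∃! X : Fin r → Matrix (Fin n) (Fin n) ℂ,
    ∀ k, A k * X k * B k - C k * X (k + 1) * D k = E k

/-! Periodic Schur forms of the two formal products turn the system, by an invertible change of
unknowns and equations, into one with upper triangular coefficients. Then entry `(i, j)` of each
equation involves only entries `(a, b)` of the unknowns with `a ≥ i` and `b ≤ j`, so the system is
block triangular. Its diagonal blocks are scalar cyclic systems `a_k y_k - b_k y_{k+1} = f_k`, where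
`a_k`, `b_k` are products of diagonal entries, and such a block is nonsingular iff `∏ a_k ≠ ∏ b_k`.

Hence nonsingularity means `∏ S_ii * ∏ R_jj ≠ ∏ U_ii * ∏ T_jj` for all `i, j`
(`periodicSylvesterNonsingular_iff_of_isPeriodicSchurForm`). A 0/0 pair in either product makes both
sides vanish; without such pairs the inequality says that the two eigenvalues differ in `ℂ ∪ {∞}`.

Schur forms exist (`FormalProduct.exists_isPeriodicSchurForm`) by deflating a cyclic chain of lines
and inducting on `n`. -/

/-! ### Propagation around the cycle `Fin r`. -/

theorem Fin.forall_of_add_one {r : ℕ} [NeZero r] {p : Fin r → Prop} (k₀ : Fin r) (h0 : p k₀)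
    (hs : ∀ k, p k → p (k + 1)) (k : Fin r) : p k := by
  have key : ∀ m : ℕ, p (k₀ + Fin.ofNat r m) := by
    intro m
    induction m with
    | zero => simpa using h0
    | succ m ih =>
      have : Fin.ofNat r (m + 1) = Fin.ofNat r m + 1 := by
        ext; simp [Fin.val_add]
      rw [this, ← add_assoc]
      exact hs _ ih
  have := key (k - k₀).val
  simpa using this

theorem Fin.forall_of_sub_one {r : ℕ} [NeZero r] {p : Fin r → Prop} (k₀ : Fin r) (h0 : p k₀)
    (hs : ∀ k, p (k + 1) → p k) (k : Fin r) : p k := by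
  have := Fin.forall_of_add_one (p := fun j => p (-j)) (-k₀) (by simpa using h0)
    (fun j hj => hs _ (by simpa using hj)) (-k)
  simpa using this

/-- Sequences indexed by `Fin r` extending a given start along relations that are total on `p`. -/
theorem Fin.exists_forward_chain {r : ℕ} [NeZero r] {V : Type*} (p : V → Prop)
    (R : Fin r → V → V → Prop) (htot : ∀ k x, p x → ∃ y, p y ∧ R k x y)
    (k₀ : Fin r) (x : V) (hx : p x) :
    ∃ z : Fin r → V, z (k₀ + 1) = x ∧ (∀ k, p (z k)) ∧ ∀ k, k ≠ k₀ → R k (z k) (z (k + 1)) := by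
  choose! f hfp hfR using htot
  let g : ℕ → V := fun m => Nat.rec x (fun i v => f (k₀ + 1 + Fin.ofNat r i) v) m
  have hgp : ∀ m, p (g m) := by
    intro m
    induction m with
    | zero => exact hx
    | succ m ih => exact hfp _ _ ih
  -- Counting steps from `k₀ + 1`, the only link that wraps around is the one at `k₀`, which is
  -- excluded.
  refine ⟨fun k => g (k - (k₀ + 1)).val, by simp [g], fun k => hgp _, fun k hk => ?_⟩
  have h1 : (k + 1 - (k₀ + 1)).val = (k - (k₀ + 1)).val + 1 := by
    have e : k + 1 - (k₀ + 1) = (k - (k₀ + 1)) + 1 := by abel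
    rw [e]
    apply Fin.val_add_one_of_lt'
    by_contra hlt
    apply hk
    have h2 : (k - (k₀ + 1)).val + 1 = r := by omega
    have h3 : k - (k₀ + 1) + 1 = 0 := by
      ext; simp [Fin.val_add, h2]
    have h4 : k - k₀ = 0 := by rw [← h3]; abel
    exact sub_eq_zero.mp h4
  simp only [h1]
  have h5 : k₀ + 1 + Fin.ofNat r (k - (k₀ + 1)).val = k := by simp
  have := hfR (k₀ + 1 + Fin.ofNat r (k - (k₀ + 1)).val) _ (hgp (k - (k₀ + 1)).val)
  rw [h5] at this
  have e : g ((k - (k₀ + 1)).val + 1) = f k (g (k - (k₀ + 1)).val) := by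
    change f (k₀ + 1 + Fin.ofNat r (k - (k₀ + 1)).val) _ = _
    rw [h5]
  rw [e]
  exact this

theorem Fin.exists_backward_chain {r : ℕ} [NeZero r] {V : Type*} (p : V → Prop)
    (R : Fin r → V → V → Prop) (htot : ∀ k y, p y → ∃ x, p x ∧ R k x y)
    (k₀ : Fin r) (x : V) (hx : p x) :
    ∃ z : Fin r → V, z k₀ = x ∧ (∀ k, p (z k)) ∧ ∀ k, k ≠ k₀ → R k (z k) (z (k + 1)) := by
  obtain ⟨z, h0, hp, hR⟩ := Fin.exists_forward_chain p (fun k u v => R (-k - 1) v u)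
    (fun k y hy => htot _ y hy) (-k₀ - 1) x hx
  refine ⟨fun k => z (-k), by simpa using h0, fun k => hp _, fun k hk => ?_⟩
  have := hR (-k - 1) (by simpa using hk)
  have e : -(-k - 1) - 1 = k := by abel
  have e2 : -(k + 1) = -k - 1 := by abel
  rw [e] at this
  change R k (z (-k)) (z (-(k + 1)))
  rw [e2]
  simpa using this

theorem Fin.prod_add_one {r : ℕ} [NeZero r] {K : Type*} [CommMonoid K] (f : Fin r → K) :
    ∏ k, f (k + 1) = ∏ k, f k :=
  Fintype.prod_equiv (Equiv.addRight (1 : Fin r)) _ _ fun _ => rfl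

/-! ### Scalar cyclic systems. -/

section CyclicSystem

variable {r : ℕ} [NeZero r] {K : Type*} [Field K]

/-- Multiplying all equations shows that some `y k` vanishes. Since one product is nonzero, this
zero spreads round the cycle: forward if all `b k ≠ 0`, backward if all `a k ≠ 0`. -/
theorem eq_zero_of_cyclic_system {a b y : Fin r → K} (hab : ∏ k, a k ≠ ∏ k, b k)
    (h : ∀ k, a k * y k = b k * y (k + 1)) : y = 0 := by
  have hz : ∃ k, y k = 0 := by
    by_contra! hy
    apply hab
    have h1 : (∏ k, a k) * ∏ k, y k = (∏ k, b k) * ∏ k, y k := by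
      rw [← Finset.prod_mul_distrib, Finset.prod_congr rfl fun k _ => h k,
        Finset.prod_mul_distrib, Fin.prod_add_one]
    exact mul_right_cancel₀ (Finset.prod_ne_zero_iff.mpr fun k _ => hy k) h1
  obtain ⟨k₀, hk₀⟩ := hz
  funext k
  by_cases ha : ∏ k, a k = 0
  · have hb : ∀ k, b k ≠ 0 := fun k =>
      Finset.prod_ne_zero_iff.mp (fun hb => hab (ha.trans hb.symm)) k (Finset.mem_univ _)
    refine Fin.forall_of_add_one (p := fun k => y k = 0) k₀ hk₀ (fun k hk => ?_) k
    have := h k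
    rw [hk, mul_zero] at this
    exact (mul_eq_zero.mp this.symm).resolve_left (hb k)
  · have ha' : ∀ k, a k ≠ 0 := fun k => Finset.prod_ne_zero_iff.mp ha k (Finset.mem_univ _)
    refine Fin.forall_of_sub_one (p := fun k => y k = 0) k₀ hk₀ (fun k hk => ?_) k
    have := h k
    rw [hk, mul_zero] at this
    exact (mul_eq_zero.mp this).resolve_left (ha' k)

theorem exists_ne_zero_of_cyclic_system {a b : Fin r → K} (hb : ∀ k, b k ≠ 0)
    (hab : ∏ k, a k = ∏ k, b k) : ∃ y : Fin r → K, y ≠ 0 ∧ ∀ k, a k * y k = b k * y (k + 1) := by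
  obtain ⟨m, rfl⟩ : ∃ m, r = m + 1 := ⟨r - 1, by have := NeZero.pos r; omega⟩
  -- Solve forward from `y 0 = 1`; the solution closes up because the full product of the `c k` is
  -- `1`.
  let c : Fin (m + 1) → K := fun k => a k / b k
  let g : Fin (m + 2) → K := Fin.partialProd c
  have hg : ∀ k : Fin (m + 1), a k * g k.castSucc = b k * g k.succ := by
    intro k
    simp only [g, Fin.partialProd_succ, c]
    field_simp [hb k]
  refine ⟨fun k => g k.castSucc, fun h => ?_, fun k => ?_⟩
  · have := congrFun h 0
    simp [g] at this
  · rw [hg]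
    congr 1
    rcases Fin.eq_castSucc_or_eq_last k with ⟨j, rfl⟩ | rfl
    · simp [Fin.coeSucc_eq_succ]
    · have h1 : g (Fin.last (m + 1)) = 1 := by
        have : g (Fin.last (m + 1)) = ∏ k, c k := by
          rw [← List.prod_ofFn]
          simp only [g, Fin.partialProd]
          rw [List.take_of_length_le (by simp)]
        rw [this]
        simp only [c, Finset.prod_div_distrib, hab]
        exact div_self (Finset.prod_ne_zero_iff.mpr fun k _ => hb k)
      simp [h1, g]

/-- If `b` first vanishes `j` steps after `k₀`, take the right-hand side supported there. The zero
at `a k₀` forces `a * y = 0` at each step up to that point, where the equation reads `0 = 1`. -/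
theorem forall_ne_zero_of_cyclic_system_surjective {a b : Fin r → K}
    (h : ∀ f : Fin r → K, ∃ y : Fin r → K, ∀ k, a k * y k - b k * y (k + 1) = f k)
    {k₀ : Fin r} (ha : a k₀ = 0) (k : Fin r) : b k ≠ 0 := by
  have key : ∀ j : ℕ, j < r → b (k₀ + Fin.ofNat r j) ≠ 0 := by
    intro j
    induction j using Nat.strong_induction_on with
    | _ j ih =>
      intro hj hb
      obtain ⟨y, hy⟩ := h (Pi.single (k₀ + Fin.ofNat r j) 1)
      have h1 : ∀ i, i ≤ j → a (k₀ + Fin.ofNat r i) * y (k₀ + Fin.ofNat r i) = 0 := by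
        intro i
        induction i with
        | zero => intro _; simp [ha]
        | succ i ihi =>
          intro hi
          have e := hy (k₀ + Fin.ofNat r i)
          have hne : k₀ + Fin.ofNat r i ≠ k₀ + Fin.ofNat r j := by
            intro he
            have := congrArg Fin.val (add_left_cancel he)
            simp only [Fin.val_ofNat] at this
            rw [Nat.mod_eq_of_lt hj, Nat.mod_eq_of_lt (by omega)] at this
            omega
          have hs : Fin.ofNat r (i + 1) = Fin.ofNat r i + 1 := by
            ext; simp [Fin.val_add]
          rw [ihi (by omega), Pi.single_eq_of_ne hne, zero_sub, neg_eq_zero, add_assoc, ← hs] at e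
          rw [(mul_eq_zero.mp e).resolve_left (ih i (by omega) (by omega)), mul_zero]
      have e := hy (k₀ + Fin.ofNat r j)
      rw [h1 j le_rfl, hb] at e
      simp at e
  have := key (k - k₀).val (k - k₀).isLt
  simpa using this

theorem prod_ne_prod_of_cyclic_system_surjective {a b : Fin r → K}
    (h : ∀ f : Fin r → K, ∃ y : Fin r → K, ∀ k, a k * y k - b k * y (k + 1) = f k) :
    ∏ k, a k ≠ ∏ k, b k := by
  intro hab
  by_cases ha : ∏ k, a k = 0
  · obtain ⟨k₀, -, hk₀⟩ := Finset.prod_eq_zero_iff.mp ha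
    obtain ⟨k₁, -, hk₁⟩ := Finset.prod_eq_zero_iff.mp (hab ▸ ha)
    exact forall_ne_zero_of_cyclic_system_surjective h hk₀ k₁ hk₁
  · rw [hab] at ha
    obtain ⟨y, hy0, hy⟩ := exists_ne_zero_of_cyclic_system
      (fun k => Finset.prod_ne_zero_iff.mp ha k (Finset.mem_univ _)) hab
    let L : (Fin r → K) →ₗ[K] (Fin r → K) :=
      { toFun := fun y k => a k * y k - b k * y (k + 1)
        map_add' := fun x y => by ext k; simp only [Pi.add_apply]; ring
        map_smul' := fun c y => by
          ext k; simp only [Pi.smul_apply, smul_eq_mul, RingHom.id_apply]; ring }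
    have hL : Function.Surjective L := fun f => (h f).imp fun y hy => funext hy
    have hinj := LinearMap.injective_iff_surjective.mpr hL
    apply hy0
    apply hinj
    rw [map_zero]
    funext k
    change a k * y k - b k * y (k + 1) = 0
    rw [hy, sub_self]

end CyclicSystem

/-! ### Existence of periodic Schur forms. -/

open Matrix

theorem exists_dependent_image {n : ℕ} (M N : Matrix (Fin n) (Fin n) ℂ) (x : Fin n → ℂ)
    (hx : x ≠ 0) : ∃ y, y ≠ 0 ∧ ∃ q, q ≠ 0 ∧ ∃ α β : ℂ, M *ᵥ x = α • q ∧ N *ᵥ y = β • q := by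
  by_cases hN : N.det = 0
  · obtain ⟨y, hy, hNy⟩ := exists_mulVec_eq_zero_iff.mpr hN
    by_cases hM : M *ᵥ x = 0
    · exact ⟨y, hy, x, hx, 0, 0, by simpa, by simpa⟩
    · exact ⟨y, hy, M *ᵥ x, hM, 1, 0, by simp, by simpa⟩
  · have hinj : ∀ v, N *ᵥ v = 0 → v = 0 := fun v hv => by
      by_contra h
      exact hN (exists_mulVec_eq_zero_iff.mp ⟨v, h, hv⟩)
    by_cases hM : M *ᵥ x = 0
    · exact ⟨x, hx, N *ᵥ x, fun h => hx (hinj _ h), 0, 1, by simpa, by simp⟩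
    · have e : N *ᵥ (N⁻¹ *ᵥ (M *ᵥ x)) = M *ᵥ x := by
        rw [mulVec_mulVec _ N, mul_nonsing_inv _ (isUnit_iff_ne_zero.mpr hN), one_mulVec]
      refine ⟨N⁻¹ *ᵥ (M *ᵥ x), fun h => hM ?_, M *ᵥ x, hM, 1, 1, by simp,
        by rw [e, one_smul]⟩
      rw [← e, h, mulVec_zero]

/-- Every formal product has a cyclic chain of one-dimensional deflating subspaces. -/
theorem exists_deflating_vectors {r n : ℕ} [NeZero r] [NeZero n]
    (M N : Fin r → Matrix (Fin n) (Fin n) ℂ) :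
    ∃ z : Fin r → Fin n → ℂ, (∀ k, z k ≠ 0) ∧ ∀ k, ∃ q, q ≠ 0 ∧ ∃ α β : ℂ,
      M k *ᵥ z k = α • q ∧ N k *ᵥ z (k + 1) = β • q := by
  let R : Fin r → (Fin n → ℂ) → (Fin n → ℂ) → Prop := fun k x y =>
    ∃ q, q ≠ 0 ∧ ∃ α β : ℂ, M k *ᵥ x = α • q ∧ N k *ᵥ y = β • q
  have htriv : ∀ {x y : Fin n → ℂ} {α β : ℂ} (q : Fin n → ℂ) (k : Fin r),
      M k *ᵥ x = α • q → N k *ᵥ y = β • q → R k x y := by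
    intro x y α β q k h1 h2
    by_cases hq : q = 0
    · exact ⟨1, one_ne_zero, 0, 0, by simp [h1, hq], by simp [h2, hq]⟩
    · exact ⟨q, hq, α, β, h1, h2⟩
  change ∃ z : Fin r → Fin n → ℂ, (∀ k, z k ≠ 0) ∧ ∀ k, R k (z k) (z (k + 1))
  -- A kernel vector of a singular factor satisfies the closing link for free, so an open chain
  -- suffices: backward for `M`, forward for `N`. If all factors are invertible, an eigenvector of
  -- the monodromy matrix closes the chain.
  by_cases hM : ∃ k, (M k).det = 0
  · obtain ⟨k₀, hk₀⟩ := hM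
    obtain ⟨x, hx, hMx⟩ := exists_mulVec_eq_zero_iff.mpr hk₀
    obtain ⟨z, hz0, hz, hR⟩ := Fin.exists_backward_chain (fun v : Fin n → ℂ => v ≠ 0) R
      (fun k y hy => by
        obtain ⟨x, hx, q, hq, α, β, h1, h2⟩ := exists_dependent_image (N k) (M k) y hy
        exact ⟨x, hx, q, hq, β, α, h2, h1⟩) k₀ x hx
    refine ⟨z, hz, fun k => ?_⟩
    by_cases hk : k = k₀
    · subst hk
      exact htriv (α := 0) (β := 1) (N k *ᵥ z (k + 1)) k (by simpa [hz0]) (by simp)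
    · exact hR k hk
  by_cases hN : ∃ k, (N k).det = 0
  · obtain ⟨k₀, hk₀⟩ := hN
    obtain ⟨x, hx, hNx⟩ := exists_mulVec_eq_zero_iff.mpr hk₀
    obtain ⟨z, hz0, hz, hR⟩ := Fin.exists_forward_chain (fun v : Fin n → ℂ => v ≠ 0) R
      (fun k y hy => exists_dependent_image (M k) (N k) y hy) k₀ x hx
    refine ⟨z, hz, fun k => ?_⟩
    by_cases hk : k = k₀
    · subst hk
      exact htriv (α := 1) (β := 0) (M k *ᵥ z k) k (by simp) (by simpa [hz0])
    · exact hR k hk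
  push Not at hM hN
  obtain ⟨m, rfl⟩ : ∃ m, r = m + 1 := ⟨r - 1, by have := NeZero.pos r; omega⟩
  let G : Fin (m + 1) → Matrix (Fin n) (Fin n) ℂ := fun k => (N k)⁻¹ * M k
  have hNG : ∀ k, N k * G k = M k := fun k => by
    simp only [G]
    rw [← mul_assoc, mul_nonsing_inv _ (isUnit_iff_ne_zero.mpr (hN k)), one_mul]
  let P : ℕ → Matrix (Fin n) (Fin n) ℂ := fun j => Nat.rec 1 (fun i X => G (Fin.ofNat _ i) * X) j
  have hP : ∀ j, P (j + 1) = G (Fin.ofNat _ j) * P j := fun j => rfl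
  have hPdet : ∀ j, (P j).det ≠ 0 := by
    intro j
    induction j with
    | zero => simp [P]
    | succ j ih =>
      rw [hP, det_mul]
      refine mul_ne_zero (fun h => hM (Fin.ofNat _ j) ?_) ih
      rw [← hNG, det_mul, h, mul_zero]
  obtain ⟨c, hc⟩ := Module.End.exists_eigenvalue (Matrix.toLin' (P (m + 1)))
  obtain ⟨z, hz⟩ := hc.exists_hasEigenvector
  have hz1 : P (m + 1) *ᵥ z = c • z := by simpa using hz.apply_eq_smul
  refine ⟨fun k => P k.val *ᵥ z, fun k h => hPdet k.val
    (exists_mulVec_eq_zero_iff.mp ⟨z, hz.2, h⟩), fun k => ?_⟩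
  have h1 : M k *ᵥ (P k.val *ᵥ z) = N k *ᵥ (P (k.val + 1) *ᵥ z) := by
    rw [hP, ← mulVec_mulVec, mulVec_mulVec _ (N k), Fin.ofNat_val_eq_self, hNG]
  rcases Fin.eq_castSucc_or_eq_last k with ⟨j, rfl⟩ | rfl
  · refine htriv (α := 1) (β := 1) _ _ (by simp only [one_smul]; exact h1) ?_
    simp [Fin.coeSucc_eq_succ]
  · refine htriv (α := c) (β := 1) (N (Fin.last m) *ᵥ z) _ ?_ ?_
    · rw [h1, Fin.val_last, hz1, mulVec_smul]
    · simp [P]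

theorem exists_unitary_col_zero {n : ℕ} (v : Fin (n + 1) → ℂ) (hv : v ≠ 0) :
    ∃ U ∈ unitaryGroup (Fin (n + 1)) ℂ, ∃ c : ℂ, c ≠ 0 ∧ ∀ i, U i 0 = c * v i := by
  let w : EuclideanSpace ℂ (Fin (n + 1)) := WithLp.toLp 2 v
  have hw : w ≠ 0 := fun h => hv (by simpa [w] using h)
  let c : ℂ := (‖w‖ : ℂ)⁻¹
  have hc : c ≠ 0 := inv_ne_zero (by simpa using hw)
  have hnorm : ‖c • w‖ = 1 := by
    rw [norm_smul]
    simp [c, hw]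
  have horth : Orthonormal ℂ (({0} : Set (Fin (n + 1))).domRestrict
      (fun _ : Fin (n + 1) => c • w)) := by
    constructor
    · intro i; exact hnorm
    · intro i j hij; exact absurd (Subsingleton.elim i j) hij
  obtain ⟨b, hb⟩ := horth.exists_orthonormalBasis_extension_of_card_eq (by simp)
  refine ⟨Matrix.of fun i j => b j i, ?_, c, hc, fun i => ?_⟩
  · rw [mem_unitaryGroup_iff']
    ext i j
    have := orthonormal_iff_ite.mp b.orthonormal i j
    rw [one_apply, ← this, PiLp.inner_apply]
    simp [mul_apply, star_apply, mul_comm]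
  · simp [hb 0 rfl, w]

/-- The block diagonal matrix with blocks `1` and `U`. -/
def oneCorner {n : ℕ} (U : Matrix (Fin n) (Fin n) ℂ) : Matrix (Fin (n + 1)) (Fin (n + 1)) ℂ :=
  Matrix.of (Fin.cons (Pi.single 0 1) fun i => Fin.cons 0 (U i))

section oneCorner

variable {n : ℕ} (U V : Matrix (Fin n) (Fin n) ℂ)

@[simp] theorem oneCorner_zero_zero : oneCorner U 0 0 = 1 := by simp [oneCorner]
@[simp] theorem oneCorner_zero_succ (j : Fin n) : oneCorner U 0 j.succ = 0 := by
  simp [oneCorner]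
@[simp] theorem oneCorner_succ_zero (i : Fin n) : oneCorner U i.succ 0 = 0 := by
  simp [oneCorner]
@[simp] theorem oneCorner_succ_succ (i j : Fin n) : oneCorner U i.succ j.succ = U i j := by
  simp [oneCorner]

theorem conjTranspose_oneCorner : (oneCorner U)ᴴ = oneCorner Uᴴ := by
  ext i j
  cases i using Fin.cases <;> cases j using Fin.cases <;> simp [conjTranspose_apply]

theorem oneCorner_mem_unitaryGroup (hU : U ∈ unitaryGroup (Fin n) ℂ) :
    oneCorner U ∈ unitaryGroup (Fin (n + 1)) ℂ := by
  rw [mem_unitaryGroup_iff, star_eq_conjTranspose] at hU ⊢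
  rw [conjTranspose_oneCorner]
  ext i j
  cases i using Fin.cases with
  | zero => cases j using Fin.cases <;>
      simp [mul_apply, Fin.sum_univ_succ, one_apply, (Fin.succ_ne_zero _).symm]
  | succ i =>
    cases j using Fin.cases with
    | zero => simp [mul_apply, Fin.sum_univ_succ, one_apply, Fin.succ_ne_zero]
    | succ j =>
      have := congrFun (congrFun hU i) j
      simpa [mul_apply, Fin.sum_univ_succ, one_apply] using this

theorem oneCorner_mul_mul_succ_zero (X : Matrix (Fin (n + 1)) (Fin (n + 1)) ℂ)
    (hX : ∀ i : Fin n, X i.succ 0 = 0) (i : Fin n) :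
    (oneCorner U * X * oneCorner V) i.succ 0 = 0 := by
  simp [mul_apply, Fin.sum_univ_succ, hX]

theorem oneCorner_mul_mul_succ_succ (X : Matrix (Fin (n + 1)) (Fin (n + 1)) ℂ) (i j : Fin n) :
    (oneCorner U * X * oneCorner V) i.succ j.succ =
      (U * X.submatrix Fin.succ Fin.succ * V) i j := by
  simp [mul_apply, Fin.sum_univ_succ]

theorem oneCorner_mul_mul_blockTriangular (X : Matrix (Fin (n + 1)) (Fin (n + 1)) ℂ)
    (hX : ∀ i : Fin n, X i.succ 0 = 0)
    (h : (U * X.submatrix Fin.succ Fin.succ * V).BlockTriangular id) :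
    (oneCorner U * X * oneCorner V).BlockTriangular id := by
  intro i j hij
  cases i using Fin.cases with
  | zero => exact absurd hij (Fin.not_lt_zero _)
  | succ i =>
    cases j using Fin.cases with
    | zero => exact oneCorner_mul_mul_succ_zero U V X hX i
    | succ j =>
      rw [oneCorner_mul_mul_succ_succ]
      exact h (Fin.succ_lt_succ_iff.mp hij)

end oneCorner

/-- `M` sends the first column of `Z` into the line of the first column of `Q`, which `Qᴴ` sends to
the first basis vector. This is the deflation step. -/
theorem unitary_conj_mul_mul_succ_zero {n : ℕ} {Q Z M : Matrix (Fin (n + 1)) (Fin (n + 1)) ℂ}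
    (hQ : Q ∈ unitaryGroup (Fin (n + 1)) ℂ) {z q : Fin (n + 1) → ℂ} {c d α : ℂ} (hd : d ≠ 0)
    (hz : ∀ i, Z i 0 = c * z i) (hq : ∀ i, Q i 0 = d * q i) (hM : M *ᵥ z = α • q) (i : Fin n) :
    (Qᴴ * M * Z) i.succ 0 = 0 := by
  have hQ' : Qᴴ * Q = 1 := mem_unitaryGroup_iff'.mp hQ
  have hZ : Z.col 0 = c • z := funext hz
  have hq' : q = d⁻¹ • Q.col 0 := by
    funext i
    simp [hq, hd]
  have h : (Qᴴ * M * Z).col 0 = (c * α * d⁻¹) • (1 : Matrix (Fin (n + 1)) (Fin (n + 1)) ℂ).col 0 := by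
    have e (X Y : Matrix (Fin (n + 1)) (Fin (n + 1)) ℂ) : (X * Y).col 0 = X *ᵥ Y.col 0 := by
      ext i; simp [mul_apply, mulVec, dotProduct]
    rw [mul_assoc, e, e, hZ, mulVec_smul, hM, hq', ← hQ', e, mulVec_smul, mulVec_smul, mulVec_smul,
      smul_smul, smul_smul, mul_assoc]
  have := congrFun h i.succ
  simpa [Fin.succ_ne_zero] using this

theorem FormalProduct.exists_isPeriodicSchurForm {r n : ℕ} [NeZero r] (P : FormalProduct r n) :
    ∃ T R, P.IsPeriodicSchurForm T R := by
  suffices h : ∀ M N : Fin r → Matrix (Fin n) (Fin n) ℂ, ∃ Q Z : Fin r → Matrix (Fin n) (Fin n) ℂ,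
      (∀ k, Q k ∈ unitaryGroup (Fin n) ℂ) ∧ (∀ k, Z k ∈ unitaryGroup (Fin n) ℂ) ∧
      (∀ k, ((Q k)ᴴ * M k * Z k).BlockTriangular id) ∧
      (∀ k, ((Q k)ᴴ * N k * Z (k + 1)).BlockTriangular id) by
    obtain ⟨Q, Z, hQ, hZ, hT, hR⟩ := h P.M P.N
    exact ⟨_, _, Q, Z, hQ, hZ, fun _ => rfl, fun _ => rfl, hT, hR⟩
  clear P
  induction n with
  | zero =>
    intro M N
    exact ⟨fun _ => 1, fun _ => 1, fun _ => one_mem _, fun _ => one_mem _,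
      fun _ i => i.elim0, fun _ i => i.elim0⟩
  | succ n ih =>
    intro M N
    obtain ⟨z, hz, h⟩ := exists_deflating_vectors M N
    choose q hq α β hα hβ using h
    choose Z hZ c hc hZc using fun k => exists_unitary_col_zero (z k) (hz k)
    choose Q hQ d hd hQd using fun k => exists_unitary_col_zero (q k) (hq k)
    obtain ⟨Q', Z', hQ', hZ', hT, hR⟩ := ih
      (fun k => ((Q k)ᴴ * M k * Z k).submatrix Fin.succ Fin.succ)
      (fun k => ((Q k)ᴴ * N k * Z (k + 1)).submatrix Fin.succ Fin.succ)
    refine ⟨fun k => Q k * oneCorner (Q' k), fun k => Z k * oneCorner (Z' k),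
      fun k => mul_mem (hQ k) (oneCorner_mem_unitaryGroup _ (hQ' k)),
      fun k => mul_mem (hZ k) (oneCorner_mem_unitaryGroup _ (hZ' k)), fun k => ?_, fun k => ?_⟩
    · have := oneCorner_mul_mul_blockTriangular _ _ _
        (unitary_conj_mul_mul_succ_zero (hQ k) (hd k) (hZc k) (hQd k) (hα k)) (hT k)
      simpa only [conjTranspose_mul, conjTranspose_oneCorner, mul_assoc] using this
    · have := oneCorner_mul_mul_blockTriangular _ _ _
        (unitary_conj_mul_mul_succ_zero (hQ k) (hd k) (hZc (k + 1)) (hQd k) (hβ k)) (hR k)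
      simpa only [conjTranspose_mul, conjTranspose_oneCorner, mul_assoc] using this


/-! ### Reduction of the Sylvester system to triangular and then scalar form. -/

section PeriodicSylvester

variable {r n : ℕ} [NeZero r] {A B C D : Fin r → Matrix (Fin n) (Fin n) ℂ}

/-- The operator `X ↦ (A_k X_k B_k - C_k X_{k+1} D_k)_k`. -/
def periodicSylvesterMap (A B C D : Fin r → Matrix (Fin n) (Fin n) ℂ) :
    (Fin r → Matrix (Fin n) (Fin n) ℂ) →ₗ[ℂ] (Fin r → Matrix (Fin n) (Fin n) ℂ) where
  toFun X k := A k * X k * B k - C k * X (k + 1) * D k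
  map_add' X Y := by
    funext k
    simp only [Pi.add_apply, mul_add, add_mul]
    abel
  map_smul' c X := by
    funext k
    simp only [Pi.smul_apply, RingHom.id_apply, Matrix.mul_smul, Matrix.smul_mul, smul_sub]

theorem periodicSylvesterNonsingular_iff_injective :
    PeriodicSylvesterNonsingular A B C D ↔ Function.Injective (periodicSylvesterMap A B C D) := by
  have h : PeriodicSylvesterNonsingular A B C D ↔
      Function.Bijective (periodicSylvesterMap A B C D) := by
    rw [Function.bijective_iff_existsUnique]
    simp only [funext_iff]
    rfl
  rw [h]
  exact ⟨fun h => h.1, fun h => ⟨h, LinearMap.injective_iff_surjective.mp h⟩⟩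

theorem periodicSylvesterNonsingular_iff_forall_eq_zero :
    PeriodicSylvesterNonsingular A B C D ↔
      ∀ X : Fin r → Matrix (Fin n) (Fin n) ℂ,
        (∀ k, A k * X k * B k - C k * X (k + 1) * D k = 0) → X = 0 := by
  rw [periodicSylvesterNonsingular_iff_injective, injective_iff_map_eq_zero]
  simp only [funext_iff (f := periodicSylvesterMap A B C D _)]
  rfl

/-- Substitute `X k = V k * Y k * S k` and multiply equation `k` by `U k` and `T k`; the indices `k
+ 1` come from `X (k + 1)`. -/
theorem periodicSylvesterNonsingular_conj_iff {U V S T : Fin r → Matrix (Fin n) (Fin n) ℂ}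
    (hU : ∀ k, IsUnit (U k)) (hV : ∀ k, IsUnit (V k)) (hS : ∀ k, IsUnit (S k))
    (hT : ∀ k, IsUnit (T k)) :
    PeriodicSylvesterNonsingular (fun k => U k * A k * V k) (fun k => S k * B k * T k)
        (fun k => U k * C k * V (k + 1)) (fun k => S (k + 1) * D k * T k) ↔
      PeriodicSylvesterNonsingular A B C D := by
  have hX0 (Y : Fin r → Matrix (Fin n) (Fin n) ℂ) :
      (fun k => V k * Y k * S k) = 0 ↔ Y = 0 := by
    simp only [funext_iff, Pi.zero_apply, (hS _).mul_left_eq_zero, (hV _).mul_right_eq_zero]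
  have heq (Y : Fin r → Matrix (Fin n) (Fin n) ℂ) (k : Fin r) :
      U k * A k * V k * Y k * (S k * B k * T k) -
          U k * C k * V (k + 1) * Y (k + 1) * (S (k + 1) * D k * T k) = 0 ↔
        A k * (V k * Y k * S k) * B k - C k * (V (k + 1) * Y (k + 1) * S (k + 1)) * D k = 0 := by
    have e : U k * A k * V k * Y k * (S k * B k * T k) -
        U k * C k * V (k + 1) * Y (k + 1) * (S (k + 1) * D k * T k) =
        U k * (A k * (V k * Y k * S k) * B k -
          C k * (V (k + 1) * Y (k + 1) * S (k + 1)) * D k) * T k := by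
      simp only [mul_sub, sub_mul, mul_assoc]
    rw [e, (hT k).mul_left_eq_zero, (hU k).mul_right_eq_zero]
  rw [periodicSylvesterNonsingular_iff_forall_eq_zero,
    periodicSylvesterNonsingular_iff_forall_eq_zero]
  constructor
  · intro h X hX
    choose V' hV' using fun k => (hV k).exists_right_inv
    choose S' hS' using fun k => (hS k).exists_left_inv
    have hXY : X = fun k => V k * (V' k * X k * S' k) * S k := by
      funext k
      rw [mul_assoc, mul_assoc (V' k * X k), hS', mul_one, ← mul_assoc, hV', one_mul]
    obtain ⟨Y, rfl⟩ : ∃ Y : Fin r → Matrix (Fin n) (Fin n) ℂ, (fun k => V k * Y k * S k) = X :=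
      ⟨_, hXY.symm⟩
    rw [hX0]
    exact h Y fun k => (heq Y k).mpr (hX k)
  · intro h Y hY
    exact (hX0 Y).mp (h _ fun k => (heq Y k).mp (hY k))

theorem mul_mul_apply_eq_zero {S Y R : Matrix (Fin n) (Fin n) ℂ} (hS : S.BlockTriangular id)
    (hR : R.BlockTriangular id) {i j : Fin n}
    (h : ∀ a b, i ≤ a → b ≤ j → Y a b = 0) : (S * Y * R) i j = 0 := by
  rw [mul_apply]
  refine Finset.sum_eq_zero fun b _ => ?_
  rcases lt_or_ge j b with hb | hb
  · rw [hR hb, mul_zero]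
  rw [mul_apply, Finset.sum_eq_zero, zero_mul]
  intro a _
  rcases lt_or_ge a i with ha | ha
  · rw [hS ha, zero_mul]
  · rw [h a b ha hb, mul_zero]

theorem mul_mul_apply_eq_of_blockTriangular {S Y R : Matrix (Fin n) (Fin n) ℂ}
    (hS : S.BlockTriangular id) (hR : R.BlockTriangular id) {i j : Fin n}
    (h : ∀ a b, i ≤ a → b ≤ j → (a, b) ≠ (i, j) → Y a b = 0) :
    (S * Y * R) i j = S i i * R j j * Y i j := by
  have hsplit : S * Y * R = S * single i j (Y i j) * R + S * (Y - single i j (Y i j)) * R := by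
    rw [← add_mul, ← mul_add, add_sub_cancel]
  have h0 : (S * (Y - single i j (Y i j)) * R) i j = 0 := by
    refine mul_mul_apply_eq_zero hS hR fun a b ha hb => ?_
    by_cases hab : (a, b) = (i, j)
    · obtain ⟨rfl, rfl⟩ := Prod.mk.inj hab
      simp
    · rw [Matrix.sub_apply, h a b ha hb hab, single_apply_of_ne, sub_zero]
      rintro ⟨rfl, rfl⟩
      exact hab rfl
  rw [hsplit, Matrix.add_apply, h0, add_zero, mul_apply,
    Finset.sum_eq_single j _ (by simp)]
  · simp
    ring
  · intro b _ hb
    simp [hb]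

theorem periodicSylvesterNonsingular_iff_of_blockTriangular
    (hA : ∀ k, (A k).BlockTriangular id) (hB : ∀ k, (B k).BlockTriangular id)
    (hC : ∀ k, (C k).BlockTriangular id) (hD : ∀ k, (D k).BlockTriangular id) :
    PeriodicSylvesterNonsingular A B C D ↔
      ∀ i j, (∏ k, A k i i) * ∏ k, B k j j ≠ (∏ k, C k i i) * ∏ k, D k j j := by
  simp only [← Finset.prod_mul_distrib]
  constructor
  · intro h i j
    rw [periodicSylvesterNonsingular_iff_injective] at h
    -- On this invariant subspace the `(i, j)` entries evolve by the scalar system alone.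
    -- Injectivity restricts to it and, by finite dimension, gives surjectivity there.
    let W : Submodule ℂ (Fin r → Matrix (Fin n) (Fin n) ℂ) :=
      { carrier := {Y | ∀ k a b, ¬ (a ≤ i ∧ j ≤ b) → Y k a b = 0}
        add_mem' := fun {X Y} hX hY k a b hab => by
          simp [hX k a b hab, hY k a b hab]
        zero_mem' := fun k a b _ => rfl
        smul_mem' := fun c X hX k a b hab => by simp [hX k a b hab] }
    have hW : ∀ Y ∈ W, periodicSylvesterMap A B C D Y ∈ W := by
      intro Y hY k a b hab
      change (A k * Y k * B k - C k * Y (k + 1) * D k) a b = 0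
      have hz : ∀ l a' b', a ≤ a' → b' ≤ b → Y l a' b' = 0 := fun l a' b' ha hb =>
        hY l a' b' fun h' => hab ⟨ha.trans h'.1, h'.2.trans hb⟩
      rw [Matrix.sub_apply, mul_mul_apply_eq_zero (hA k) (hB k) (hz k),
        mul_mul_apply_eq_zero (hC k) (hD k) (hz (k + 1)), sub_zero]
    have hinj : Function.Injective ((periodicSylvesterMap A B C D).restrict hW) := by
      intro X Y hXY
      exact Subtype.ext (h (congrArg Subtype.val hXY))
    have hsurj := LinearMap.injective_iff_surjective.mp hinj
    refine prod_ne_prod_of_cyclic_system_surjective fun f => ?_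
    obtain ⟨⟨Y, hY⟩, hYf⟩ := hsurj ⟨fun k => single i j (f k), fun k a b hab => by
      apply single_apply_of_ne
      rintro ⟨rfl, rfl⟩
      exact hab ⟨le_rfl, le_rfl⟩⟩
    refine ⟨fun k => Y k i j, fun k => ?_⟩
    have hz : ∀ l a b, i ≤ a → b ≤ j → (a, b) ≠ (i, j) → Y l a b = 0 := by
      intro l a b ha hb hab
      refine hY l a b fun h' => hab ?_
      rw [le_antisymm h'.1 ha, le_antisymm hb h'.2]
    have e : (A k * Y k * B k - C k * Y (k + 1) * D k) i j = single i j (f k) i j :=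
      congrFun (congrFun (congrFun (congrArg Subtype.val hYf) k) i) j
    rwa [Matrix.sub_apply, mul_mul_apply_eq_of_blockTriangular (hA k) (hB k) (hz k),
      mul_mul_apply_eq_of_blockTriangular (hC k) (hD k) (hz (k + 1)), single_apply_same] at e
  · intro h
    rw [periodicSylvesterNonsingular_iff_forall_eq_zero]
    intro Y hY
    -- Back substitution from the lower left corner: the measure drops whenever `i` grows or `j`
    -- shrinks.
    have key : ∀ m : ℕ, ∀ i j : Fin n, n - i.val + j.val = m → ∀ k, Y k i j = 0 := by
      intro m
      induction m using Nat.strong_induction_on with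
      | _ m ih =>
        intro i j hm
        have hz : ∀ l a b, i ≤ a → b ≤ j → (a, b) ≠ (i, j) → Y l a b = 0 := by
          intro l a b ha hb hab
          refine ih (n - a.val + b.val) ?_ a b rfl l
          have : ¬ (a.val = i.val ∧ b.val = j.val) := fun h' =>
            hab (Prod.ext (Fin.ext h'.1) (Fin.ext h'.2))
          have ha' : i.val ≤ a.val := ha
          have hb' : b.val ≤ j.val := hb
          have := a.isLt
          omega
        refine congrFun (eq_zero_of_cyclic_system (h i j) (y := fun k => Y k i j) fun k => ?_)
        have e := congrFun (congrFun (hY k) i) j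
        rw [Matrix.sub_apply, mul_mul_apply_eq_of_blockTriangular (hA k) (hB k) (hz k),
          mul_mul_apply_eq_of_blockTriangular (hC k) (hD k) (hz (k + 1))] at e
        exact sub_eq_zero.mp e
    funext k
    ext i j
    exact key _ i j rfl k

/-- Valid for any pair of forms, so independence of regularity and spectrum from the chosen form is
never needed. -/
theorem periodicSylvesterNonsingular_iff_of_isPeriodicSchurForm
    {S U T R : Fin r → Matrix (Fin n) (Fin n) ℂ}
    (h₁ : (FormalProduct.invMul C A).IsPeriodicSchurForm S U)
    (h₂ : (FormalProduct.mulInv D B).IsPeriodicSchurForm T R) :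
    PeriodicSylvesterNonsingular A B C D ↔
      ∀ i j, (∏ k, S k i i) * ∏ k, R k j j ≠ (∏ k, U k i i) * ∏ k, T k j j := by
  obtain ⟨Q, Z, hQ, hZ, hS, hU, hSt, hUt⟩ := h₁
  obtain ⟨P, W, hP, hW, hT, hR, hTt, hRt⟩ := h₂
  have hunit {X : Matrix (Fin n) (Fin n) ℂ} (hX : X ∈ unitaryGroup (Fin n) ℂ) : IsUnit X :=
    IsUnit.of_mul_eq_one _ (mem_unitaryGroup_iff.mp hX)
  have hunit' {X : Matrix (Fin n) (Fin n) ℂ} (hX : X ∈ unitaryGroup (Fin n) ℂ) : IsUnit Xᴴ :=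
    IsUnit.of_mul_eq_one _ (mem_unitaryGroup_iff'.mp hX)
  -- The shift arises because the `k`-th denominator of `mulInv D B` is `B (k + 1)`: thus `P k` acts
  -- on both `D k` and `B (k + 1)`.
  rw [← periodicSylvesterNonsingular_conj_iff (U := fun k => (Q k)ᴴ) (V := Z)
    (S := fun k => (P (k - 1))ᴴ) (T := W) (fun k => hunit' (hQ k)) (fun k => hunit (hZ k))
    (fun k => hunit' (hP _)) (fun k => hunit (hW k))]
  have hR' : (fun k => (P (k - 1))ᴴ * B k * W k) = fun k => R (k - 1) := by
    funext k
    rw [← hR]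
    simp [FormalProduct.mulInv]
  have hT' : (fun k => (P (k + 1 - 1))ᴴ * D k * W k) = T := by
    funext k
    rw [← hT, add_sub_cancel_right]
    rfl
  have hS' : (fun k => (Q k)ᴴ * A k * Z k) = S := funext hS
  have hU' : (fun k => (Q k)ᴴ * C k * Z (k + 1)) = U := funext hU
  rw [hR', hT', hS', hU', periodicSylvesterNonsingular_iff_of_blockTriangular hSt
    (fun k => hRt _) hUt hTt]
  have hprod : ∀ j, ∏ k, R (k - 1) j j = ∏ k, R k j j := fun j => by
    rw [← Fin.prod_add_one]
    simp
  simp only [hprod]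

end PeriodicSylvester

/-! ### From product inequalities to regularity and disjoint spectra. -/

theorem FormalProduct.ratio_eq_ratio_iff {a b c d : ℂ} (hab : ¬ (a = 0 ∧ b = 0))
    (hcd : ¬ (c = 0 ∧ d = 0)) : ratio a b = ratio c d ↔ a * d = b * c := by
  unfold ratio
  by_cases hb : b = 0 <;> by_cases hd : d = 0
  · simp [hb, hd]
  · simp_all [OnePoint.infty_ne_coe]
  · simp_all [OnePoint.coe_ne_infty]
  · simp only [hb, hd, if_false, OnePoint.coe_eq_coe]
    rw [div_eq_div_iff hb hd, mul_comm c b]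

theorem theorem4p1 {r n : ℕ} [NeZero r] (A B C D : Fin r → Matrix (Fin n) (Fin n) ℂ) :
    PeriodicSylvesterNonsingular A B C D ↔
      (FormalProduct.invMul C A).IsRegular ∧ (FormalProduct.mulInv D B).IsRegular ∧
        Disjoint (FormalProduct.invMul C A).spectrum (FormalProduct.mulInv D B).spectrum := by
  constructor
  · intro h
    obtain ⟨S, U, h₁⟩ := (FormalProduct.invMul C A).exists_isPeriodicSchurForm
    obtain ⟨T, R, h₂⟩ := (FormalProduct.mulInv D B).exists_isPeriodicSchurForm
    have h' := (periodicSylvesterNonsingular_iff_of_isPeriodicSchurForm h₁ h₂).mp h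
    refine ⟨⟨S, U, h₁, fun i hi => h' i i (by simp [hi])⟩,
      ⟨T, R, h₂, fun i hi => h' i i (by simp [hi])⟩, ?_⟩
    rw [Set.disjoint_left]
    rintro _ ⟨S, U, h₁, i, rfl⟩ ⟨T, R, h₂, j, hij⟩
    have h' := (periodicSylvesterNonsingular_iff_of_isPeriodicSchurForm h₁ h₂).mp h i j
    exact h' ((FormalProduct.ratio_eq_ratio_iff (fun hi => h' (by simp [hi]))
      (fun hj => h' (by simp [hj]))).mp hij)
  · rintro ⟨⟨S, U, h₁, hSU⟩, ⟨T, R, h₂, hTR⟩, hdisj⟩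
    rw [periodicSylvesterNonsingular_iff_of_isPeriodicSchurForm h₁ h₂]
    intro i j hij
    exact Set.disjoint_left.mp hdisj ⟨S, U, h₁, i, rfl⟩
      ⟨T, R, h₂, j, (FormalProduct.ratio_eq_ratio_iff (hSU i) (hTR j)).mpr hij⟩
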